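/- All rings are commutative with $1$. Let $R$ be a ring. An injective homomorphism $f\colon A\to B$ of $R$-modules is called a pure injection if $f\otimes 1_X\colon A\otimes_R X\to B\otimes_R X$ is injective for every $R$-module $X$. A short exact sequence $0\to A\xrightarrow{f} B\to C\to 0$ of $R$-modules is called pure if $f$ is a pure injection. An $R$-module $M$ is pure-projective if $\operatorname{Hom}_R(M,B)\to\operatorname{Hom}_R(M,C)$ is surjective for every pure short exact sequence $0\to A\to B\to C\to 0$ of $R$-modules. A ring extension $R\subseteq S$ is pure if the inclusion $R\hookrightarrow S$ is a pure injection of $R$-modules. (1) Let $R\subseteq S$ be a pure extension of commutative rings, and let $M$ be an $R$-module. Then $M$ is a pure-projective $R$-module if and only if $M\otimes_R S$ is a pure-projective $S$-module. (2) Let $R$ be a commutative noetherian local ring with maximal ideal $\mathfrak m$, let $\widehat R$ be its $\mathfrak m$-adic completion, and let $P$ be an $R$-module. Then $P$ is a pure-projective $R$-module if and only if $P\otimes_R\widehat R$ is a pure-projective $\widehat R$-module. -/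

import Mathlib

open scoped TensorProduct

universe u v w

/-- An injective linear map `f : A → B` is a *pure injection* if `f ⊗ 1_X : A ⊗ X → B ⊗ X` is
injective for every `R`-module `X`. It suffices to test finitely presented modules `X`, and these
all have a copy in the universe of `R`, so letting `X` range over that universe loses nothing. -/
structure IsPureInjection {R : Type u} [CommRing R] {A : Type v} {B : Type w}
    [AddCommGroup A] [Module R A] [AddCommGroup B] [Module R B] (f : A →ₗ[R] B) : Prop where
  injective : Function.Injective f
  rTensor_injective : ∀ (X : Type u) [AddCommGroup X] [Module R X],
    Function.Injective (f.rTensor X)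

/-- `0 → A → B → C → 0` is a pure (short) exact sequence. -/
structure IsPureExact {R : Type u} [CommRing R] {A B C : Type v}
    [AddCommGroup A] [Module R A] [AddCommGroup B] [Module R B] [AddCommGroup C] [Module R C]
    (f : A →ₗ[R] B) (g : B →ₗ[R] C) : Prop where
  pure : IsPureInjection f
  exact : Function.Exact f g
  surjective : Function.Surjective g

/-- `M` is *pure-projective* if `Hom(M, B) → Hom(M, C)` is surjective for every pure exact
sequence `0 → A → B → C → 0`. The universe `max u v` contains copies of `M` and of all direct sums,
indexed by small sets, of finitely presented modules, in particular of a pure presentation of `M`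
by such a sum; so larger universes would give the same notion. -/
def IsPureProjective (R : Type u) [CommRing R] (M : Type v) [AddCommGroup M] [Module R M] : Prop :=
  ∀ (A B C : Type (max u v)) [AddCommGroup A] [Module R A] [AddCommGroup B] [Module R B]
    [AddCommGroup C] [Module R C] (f : A →ₗ[R] B) (g : B →ₗ[R] C), IsPureExact f g →
    ∀ h : M →ₗ[R] C, ∃ k : M →ₗ[R] B, g ∘ₗ k = h

/-- An `R`-algebra `S` is a *pure extension* of `R` if the structure map `R → S` is a pure
injection of `R`-modules. -/
def IsPureExtension (R : Type u) (S : Type v) [CommRing R] [CommRing S] [Algebra R S] : Prop :=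
  IsPureInjection (Algebra.linearMap R S)

/-! A pure-projective module is a retract of a direct sum of finitely presented modules
(`IsPureProjective.exists_retract`), along which maps lift summand by summand; this form survives
base change.

For descent, let `S ⊗ M` be a retract of `⨁ F i`. After base change, a map `X → M` with `X` finitely
presented meets only finitely many summands, whose sum is finitely presented; hence some stage `X →
Y` over `M` has a base change extending to `S ⊗ M` (`FPModuleOver.exists_extension_of_retract`).
Purity of `R → S` turns this into a Mittag-Leffler condition: whatever dies in `M ⊗ W` already dies
in `Y ⊗ W`. Iterating countably often gives a pure submodule that is pure-projective
(`FPTower.isPureProjective_union`).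

If a pure submodule `N` is compatible with a set of summands, then `S ⊗ (M ⧸ N)` is again a retract
of `⨁ F i`, so the construction repeats in the quotient (`IsAdapted.exists_extend`). The resulting
extensions split, and Zorn's lemma on partial lifts reaches all of `M`. The completion in the second
statement is faithfully flat, hence pure. -/

/-! ### Purity, linear systems and lifting from finitely presented modules -/

section Purity

variable {R : Type u} [CommRing R]

/-- A quotient of a finitely presented module by a finitely generated submodule. -/
theorem finitePresentation_quotient_of_fg {E : Type*} [AddCommGroup E] [Module R E]
    [Module.FinitePresentation R E] {K : Submodule R E} (hK : K.FG) :
    Module.FinitePresentation R (E ⧸ K) :=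
  Module.finitePresentation_of_surjective K.mkQ K.mkQ_surjective (by simpa using hK)

section

variable {A B C : Type*} [AddCommGroup A] [Module R A] [AddCommGroup B] [Module R B]
  [AddCommGroup C] [Module R C]

/-- A linear map vanishing on the kernel of a surjection factors through it. -/
theorem LinearMap.exists_comp_eq_of_ker_le (q : A →ₗ[R] B) (hq : Function.Surjective q)
    (f : A →ₗ[R] C) (hf : LinearMap.ker q ≤ LinearMap.ker f) : ∃ k : B →ₗ[R] C, k ∘ₗ q = f := by
  refine ⟨(LinearMap.ker q).liftQ f hf ∘ₗ (q.quotKerEquivOfSurjective hq).symm.toLinearMap,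
    LinearMap.ext fun x => ?_⟩
  have : (q.quotKerEquivOfSurjective hq).symm (q x) = (LinearMap.ker q).mkQ x := by
    rw [LinearEquiv.symm_apply_eq]
    simp
  simp [this]

/-- A finite system of linear equations with constants in a pure submodule that is solvable in the
ambient module is solvable in the submodule. -/
theorem IsPureInjection.exists_solution {f : A →ₗ[R] B} (hf : IsPureInjection f)
    {m n : ℕ} (r : Fin m → Fin n → R) (a : Fin m → A) (b : Fin n → B)
    (hab : ∀ l, f (a l) = ∑ j, r l j • b j) :
    ∃ a' : Fin n → A, ∀ l, a l = ∑ j, r l j • a' j := by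
  classical
  -- The test module is the cokernel of the coefficient matrix: the system is solvable in a module
  -- exactly when `∑ a l ⊗ e l` vanishes over it.
  let D : (Fin n → R) →ₗ[R] (Fin m → R) := Matrix.mulVecLin r
  let e : Fin m → (Fin m → R) ⧸ LinearMap.range D :=
    fun l => (LinearMap.range D).mkQ (Pi.single l 1)
  have hcomb (c : Fin m → R) : ∑ l, c l • e l = (LinearMap.range D).mkQ c := by
    simp only [e, ← map_smul, ← map_sum]
    congr 1
    exact (pi_eq_sum_univ' c).symm
  have hD (j : Fin n) : ∑ l, r l j • e l = 0 := by
    rw [hcomb (fun l => r l j)]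
    simp only [Submodule.mkQ_apply, Submodule.Quotient.mk_eq_zero]
    refine ⟨Pi.single j 1, ?_⟩
    ext l
    exact congr_fun (Matrix.mulVec_single_one r j) l
  have hzero : ∑ l, a l ⊗ₜ[R] e l = 0 := by
    apply hf.rTensor_injective
    simp only [map_sum, LinearMap.rTensor_tmul, hab, TensorProduct.sum_tmul, map_zero,
      ← TensorProduct.smul_tmul']
    rw [Finset.sum_comm]
    refine Finset.sum_eq_zero fun j _ => ?_
    simp only [← TensorProduct.tmul_smul, ← TensorProduct.tmul_sum, hD, TensorProduct.tmul_zero]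
  have hspan : Submodule.span R (Set.range e) = ⊤ := by
    rw [eq_top_iff]
    rintro x -
    obtain ⟨c, rfl⟩ := (LinearMap.range D).mkQ_surjective x
    rw [← hcomb]
    exact Submodule.sum_mem _ fun l _ => Submodule.smul_mem _ _ (Submodule.subset_span ⟨l, rfl⟩)
  have hzero' : ∑ l, e l ⊗ₜ[R] a l = 0 := by
    apply (TensorProduct.comm R _ _).injective
    simpa using hzero
  obtain ⟨k, c, y, hy, hc⟩ :=
    TensorProduct.vanishesTrivially_of_sum_tmul_eq_zero R hspan hzero'
  have hd (i : Fin k) : ∃ d : Fin n → R, D d = fun l => c l i := by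
    have := hc i
    rw [hcomb (fun l => c l i)] at this
    simpa [Submodule.Quotient.mk_eq_zero] using this
  choose d hd using hd
  refine ⟨fun j => ∑ i, d i j • y i, fun l => ?_⟩
  have hcl (i : Fin k) : c l i = ∑ j, r l j * d i j := (congr_fun (hd i) l).symm
  simp only [hy l, hcl, Finset.sum_smul, Finset.smul_sum, smul_smul]
  exact Finset.sum_comm

/-- Finitely presented modules lift along pure epimorphisms. -/
theorem IsPureInjection.exists_lift_of_finitePresentation {f : A →ₗ[R] B} {g : B →ₗ[R] C}
    (hf : IsPureInjection f) (hfg : Function.Exact f g) (hg : Function.Surjective g)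
    {E : Type*} [AddCommGroup E] [Module R E] [Module.FinitePresentation R E] (h : E →ₗ[R] C) :
    ∃ k : E →ₗ[R] B, g ∘ₗ k = h := by
  classical
  obtain ⟨n, m, q, rel, hq, hex⟩ := Module.FinitePresentation.exists_fin' R E
  obtain ⟨b, hb⟩ := Module.projective_lifting_property g (h ∘ₗ q) hg
  have hrel (l : Fin m) : ∃ a, f a = b (rel (Pi.single l 1)) := by
    refine (hfg _).1 ?_
    rw [← LinearMap.comp_apply, hb, LinearMap.comp_apply, hex.apply_apply_eq_zero, map_zero]
  choose a ha using hrel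
  have hsum {N : Type _} [AddCommGroup N] [Module R N] (φ : (Fin n → R) →ₗ[R] N) (x : Fin n → R) :
      φ x = ∑ j, x j • φ (Pi.single j 1) := by
    conv_lhs => rw [pi_eq_sum_univ' x]
    simp
  -- The values of `b` on the relations form a system with constants in `A`, solved in `B` by `b`
  -- itself. Subtracting a solution from `A` makes the lift kill the relations.
  obtain ⟨a', ha'⟩ := hf.exists_solution (fun l => rel (Pi.single l 1)) a
    (fun j => b (Pi.single j 1)) (fun l => by rw [ha, hsum b])
  let k' : (Fin n → R) →ₗ[R] B := b - f ∘ₗ Fintype.linearCombination R a'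
  have hk' : LinearMap.ker q ≤ LinearMap.ker k' := by
    rw [hex.linearMap_ker_eq]
    rintro _ ⟨x, rfl⟩
    have : k' ∘ₗ rel = 0 := by
      refine LinearMap.pi_ext' fun l => LinearMap.ext_ring ?_
      simp [k', ← ha, ha' l, Fintype.linearCombination_apply]
    simpa using LinearMap.congr_fun this x
  obtain ⟨k, hk⟩ := q.exists_comp_eq_of_ker_le hq k' hk'
  refine ⟨k, ?_⟩
  rw [← LinearMap.cancel_right hq, LinearMap.comp_assoc, hk, ← hb]
  ext
  simp [k', hfg.apply_apply_eq_zero]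

/-- If `s` generates `Q`, every element of `Q ⊗ A` has the form `∑ i, s i ⊗ a i`. -/
theorem TensorProduct.exists_sum_tmul_of_span_eq_top {Q : Type*} [AddCommGroup Q] [Module R Q]
    {n : ℕ} {s : Fin n → Q} (hs : Submodule.span R (Set.range s) = ⊤) (t : Q ⊗[R] A) :
    ∃ a : Fin n → A, t = ∑ i, s i ⊗ₜ[R] a i := by
  induction t with
  | zero => exact ⟨0, by simp⟩
  | tmul x y =>
    have hx : x ∈ Submodule.span R (Set.range s) := hs ▸ Submodule.mem_top
    obtain ⟨c, rfl⟩ := (Submodule.mem_span_range_iff_exists_fun R).1 hx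
    exact ⟨fun i => c i • y, by simp [TensorProduct.sum_tmul, TensorProduct.smul_tmul]⟩
  | add x y hx hy =>
    obtain ⟨a, rfl⟩ := hx
    obtain ⟨b, rfl⟩ := hy
    exact ⟨a + b, by simp [TensorProduct.tmul_add, Finset.sum_add_distrib]⟩

/-- A linear map whose base change to `R` itself is injective is injective. -/
theorem LinearMap.injective_of_rTensor_self {f : A →ₗ[R] B}
    (hf : Function.Injective (f.rTensor R)) : Function.Injective f := by
  rw [injective_iff_map_eq_zero]
  intro x hx
  have : x ⊗ₜ[R] (1 : R) = 0 := hf (by simp [hx])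
  simpa using congr_arg (TensorProduct.rid R A) this

/-- An exact sequence along which finitely presented modules lift is pure. -/
theorem isPureInjection_of_exists_lift {f : A →ₗ[R] B} {g : B →ₗ[R] C}
    (hf : Function.Injective f) (hfg : Function.Exact f g)
    (hlift : ∀ (E : Type u) [AddCommGroup E] [Module R E] [Module.FinitePresentation R E]
      (h : E →ₗ[R] C), ∃ k : E →ₗ[R] B, g ∘ₗ k = h) :
    IsPureInjection f := by
  classical
  refine ⟨hf, fun W _ _ => ?_⟩
  rw [← LinearMap.lTensor_inj_iff_rTensor_inj, injective_iff_map_eq_zero]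
  intro z hz
  obtain ⟨P, hP, t, rfl⟩ := TensorProduct.exists_of_fg z
  rw [← LinearMap.comp_apply, LinearMap.lTensor_comp_rTensor, ← LinearMap.rTensor_comp_lTensor,
    LinearMap.comp_apply] at hz
  obtain ⟨Q, hPQ, hQ, ht⟩ := TensorProduct.eq_zero_of_fg_of_subtype_eq_zero hP hz
  rw [← LinearMap.comp_apply, LinearMap.rTensor_comp_lTensor, ← LinearMap.lTensor_comp_rTensor,
    LinearMap.comp_apply] at ht
  suffices h0 : (Submodule.inclusion hPQ).rTensor A t = 0 by
    rw [← Submodule.subtype_comp_inclusion _ _ hPQ, LinearMap.rTensor_comp, LinearMap.comp_apply,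
      h0, map_zero]
  generalize (Submodule.inclusion hPQ).rTensor A t = t' at ht
  have : Module.Finite R Q := Module.Finite.iff_fg.2 hQ
  obtain ⟨n, s, hs⟩ := Module.Finite.exists_fin (R := R) (M := Q)
  obtain ⟨a, rfl⟩ := TensorProduct.exists_sum_tmul_of_span_eq_top hs t'
  simp only [map_sum, LinearMap.lTensor_tmul] at ht
  obtain ⟨k, c, y, hy, hc⟩ := TensorProduct.vanishesTrivially_of_sum_tmul_eq_zero R hs ht
  -- The equations `f (a i) = ∑ j, c i j • y j` become homogeneous in `C`, so `g ∘ y` is a map from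
  -- the module with relations `c i`. Subtracting a lift of it from `y` gives a solution in `A`.
  let K : Submodule R (Fin k → R) := Submodule.span R (Set.range c)
  have : Module.FinitePresentation R ((Fin k → R) ⧸ K) :=
    finitePresentation_quotient_of_fg (Submodule.fg_span (Set.finite_range c))
  obtain ⟨φ, hφ⟩ := hlift _ (K.liftQ (Fintype.linearCombination R (g ∘ y)) (by
    rw [Submodule.span_le]
    rintro _ ⟨i, rfl⟩
    have := hfg.apply_apply_eq_zero (a i)
    simpa [Fintype.linearCombination_apply, hy i] using this))
  have hy' (j : Fin k) : ∃ a', f a' = y j - φ (K.mkQ (Pi.single j 1)) := by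
    refine (hfg _).1 ?_
    have := LinearMap.congr_fun hφ (K.mkQ (Pi.single j 1))
    rw [map_sub, ← LinearMap.comp_apply, this]
    simp
  choose a' ha' using hy'
  apply TensorProduct.sum_tmul_eq_zero_of_vanishesTrivially
  refine ⟨k, c, a', fun i => hf ?_, hc⟩
  have hi : φ (K.mkQ (c i)) = ∑ j, c i j • φ (K.mkQ (Pi.single j 1)) := by
    conv_lhs => rw [pi_eq_sum_univ' (c i)]
    simp
  have hi0 : K.mkQ (c i) = 0 := by
    simpa using Submodule.subset_span (Set.mem_range_self i)
  rw [hi0, map_zero] at hi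
  simp only [map_sum, map_smul, ha', smul_sub, Finset.sum_sub_distrib, ← hi, sub_zero]
  exact hy i

end

/-- If the tensor kernels of `g'` are contained in those of `g`, and the target of `g'` is
finitely presented, then `g` factors through `g'`. -/
theorem exists_comp_eq_of_ker_rTensor_le {E E' Q : Type*} [AddCommGroup E] [Module R E]
    [AddCommGroup E'] [Module R E'] [AddCommGroup Q] [Module R Q] [Module.Finite R E]
    [Module.FinitePresentation R E'] (g' : E →ₗ[R] E') (g : E →ₗ[R] Q)
    (hker : ∀ (W : Type u) [AddCommGroup W] [Module R W],
      LinearMap.ker (g'.rTensor W) ≤ LinearMap.ker (g.rTensor W)) :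
    ∃ r : E' →ₗ[R] Q, r ∘ₗ g' = g := by
  -- Form the pushout of `g'` and `g`. The kernel hypothesis makes `Q → pushout` pure, and its
  -- cokernel is that of `g'`, hence finitely presented; so it splits, and the retraction restricted
  -- to `E'` is the factorization.
  let d : E →ₗ[R] E' × Q := g'.prod (-g)
  let p : E' × Q →ₗ[R] (E' × Q) ⧸ LinearMap.range d := (LinearMap.range d).mkQ
  let inQ : Q →ₗ[R] (E' × Q) ⧸ LinearMap.range d := p ∘ₗ LinearMap.inr R E' Q
  have hpd : Function.Exact d p := by simp [p, LinearMap.exact_iff]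
  have hinj (W : Type u) [AddCommGroup W] [Module R W] : Function.Injective (inQ.rTensor W) := by
    rw [injective_iff_map_eq_zero]
    intro z hz
    rw [LinearMap.rTensor_comp, LinearMap.comp_apply] at hz
    obtain ⟨t, ht⟩ := (rTensor_exact W hpd (Submodule.mkQ_surjective _) _).1 hz
    have h1 := congr_arg ((LinearMap.fst R E' Q).rTensor W) ht
    have h2 := congr_arg ((LinearMap.snd R E' Q).rTensor W) ht
    simp only [← LinearMap.comp_apply, ← LinearMap.rTensor_comp] at h1 h2
    simp only [d, LinearMap.fst_prod, LinearMap.snd_prod, LinearMap.fst_comp_inr,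
      LinearMap.snd_comp_inr, LinearMap.rTensor_zero, LinearMap.rTensor_id,
      LinearMap.rTensor_neg, LinearMap.zero_apply, LinearMap.id_apply, LinearMap.neg_apply] at h1 h2
    have := hker W h1
    rw [LinearMap.mem_ker] at this
    rw [← h2, this, neg_zero]
  have hpure : IsPureInjection inQ :=
    ⟨LinearMap.injective_of_rTensor_self (hinj R), fun W _ _ => hinj W⟩
  have : Module.FinitePresentation R (E' ⧸ LinearMap.range g') :=
    finitePresentation_quotient_of_fg (by simp)
  let q : ((E' × Q) ⧸ LinearMap.range d) →ₗ[R] E' ⧸ LinearMap.range g' :=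
    (LinearMap.range d).liftQ ((LinearMap.range g').mkQ ∘ₗ LinearMap.fst R E' Q) (by
      rintro _ ⟨e, rfl⟩
      simp [d])
  have hq : Function.Surjective q := by
    intro x
    obtain ⟨y, rfl⟩ := Submodule.mkQ_surjective _ x
    exact ⟨p (y, 0), by simp [q, p]⟩
  have hpg (e : E) : p (g' e, 0) = inQ (g e) := by
    rw [← sub_eq_zero]
    simp only [inQ, LinearMap.comp_apply, ← map_sub]
    exact (Submodule.Quotient.mk_eq_zero _).2 ⟨e, by simp [d]⟩
  have hexact : Function.Exact inQ q := by
    intro y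
    constructor
    · obtain ⟨⟨e', x⟩, rfl⟩ := Submodule.mkQ_surjective _ y
      intro h
      obtain ⟨e, rfl⟩ : e' ∈ LinearMap.range g' := by simpa [q] using h
      refine ⟨g e + x, ?_⟩
      rw [map_add, ← hpg, LinearMap.comp_apply, ← map_add]
      simp [p]
    · rintro ⟨x, rfl⟩
      simp [q, inQ, p]
  obtain ⟨s, hs⟩ := hpure.exists_lift_of_finitePresentation hexact hq LinearMap.id
  obtain ⟨-, ρ, hρ⟩ : Function.Surjective q ∧ ∃ ρ, ρ ∘ₗ inQ = LinearMap.id :=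
    (hexact.split_tfae'.out 0 1 rfl rfl).1 ⟨hpure.injective, s, hs⟩
  refine ⟨ρ ∘ₗ p ∘ₗ LinearMap.inl R E' Q, LinearMap.ext fun e => ?_⟩
  simpa [hpg] using LinearMap.congr_fun hρ (g e)

end Purity

/-! ### Pure presentations, base change and pure extensions -/

section Presentation

variable {R : Type u} [CommRing R]

/-- Every module receives a map from a direct sum of finitely presented modules along which all
maps from finitely presented modules lift. -/
theorem exists_dfinsupp_lift_of_finitePresentation (R : Type u) [CommRing R] (M : Type w)
    [AddCommGroup M] [Module R M] :
    ∃ (I : Type (max u w)) (F : I → Type u) (_ : ∀ i, AddCommGroup (F i))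
      (_ : ∀ i, Module R (F i)) (_ : ∀ i, Module.FinitePresentation R (F i))
      (p : (Π₀ i, F i) →ₗ[R] M), ∀ (E : Type u) [AddCommGroup E] [Module R E]
        [Module.FinitePresentation R E] (h : E →ₗ[R] M),
        ∃ k : E →ₗ[R] Π₀ i, F i, p ∘ₗ k = h := by
  classical
  have H (I : Type (max u w)) (F : I → Type u) [∀ i, AddCommGroup (F i)] [∀ i, Module R (F i)]
      (m : ∀ i, F i →ₗ[R] M) : ∃ p : (Π₀ i, F i) →ₗ[R] M, ∀ (E : Type u) [AddCommGroup E]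
      [Module R E] (i : I) (e : E →ₗ[R] F i), ∃ k : E →ₗ[R] Π₀ i, F i, p ∘ₗ k = m i ∘ₗ e :=
    ⟨DFinsupp.lsum ℕ m, fun E _ _ i e => ⟨DFinsupp.lsingle i ∘ₗ e, by ext; simp⟩⟩
  -- Quotients of `R ^ n` represent all finitely presented modules, which keeps the index set small.
  let I := Σ (n : ℕ) (K : {K : Submodule R (Fin n → R) // K.FG}), ((Fin n → R) ⧸ K.1) →ₗ[R] M
  let F : I → Type u := fun i => (Fin i.1 → R) ⧸ i.2.1.1
  let iF : ∀ i, AddCommGroup (F i) := fun i => Submodule.Quotient.addCommGroup i.2.1.1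
  let mF : ∀ i, Module R (F i) := fun i => Submodule.Quotient.module i.2.1.1
  let m : ∀ i, F i →ₗ[R] M := fun i => i.2.2
  obtain ⟨p, hp⟩ := H I F m
  refine ⟨I, F, iF, mF, fun i => finitePresentation_quotient_of_fg i.2.1.2, p, ?_⟩
  intro E _ _ _ h
  obtain ⟨n, K, e, hK⟩ := Module.FinitePresentation.exists_fin R E
  obtain ⟨k, hk⟩ := hp E ⟨n, ⟨K, hK⟩, h ∘ₗ e.symm.toLinearMap⟩ e.toLinearMap
  exact ⟨k, hk.trans (LinearMap.ext fun x => by simp [m])⟩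

/-- A pure-projective module is a retract of a direct sum of finitely presented modules. -/
theorem IsPureProjective.exists_retract {M : Type w} [AddCommGroup M] [Module R M]
    (hM : IsPureProjective R M) :
    ∃ (I : Type (max u w)) (F : I → Type u) (_ : ∀ i, AddCommGroup (F i))
      (_ : ∀ i, Module R (F i)) (_ : ∀ i, Module.FinitePresentation R (F i))
      (s : M →ₗ[R] Π₀ i, F i) (p : (Π₀ i, F i) →ₗ[R] M), p ∘ₗ s = LinearMap.id := by
  obtain ⟨I, F, _, _, hF, p, hlift⟩ := exists_dfinsupp_lift_of_finitePresentation R M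
  let q : (Π₀ i, F i) →ₗ[R] ULift.{u} M := ULift.moduleEquiv.symm.toLinearMap ∘ₗ p
  have hsurj : Function.Surjective p := by
    intro x
    obtain ⟨k, hk⟩ := hlift R (LinearMap.toSpanSingleton R M x)
    exact ⟨k 1, by simpa using LinearMap.congr_fun hk 1⟩
  have hex : Function.Exact (LinearMap.ker q).subtype q := LinearMap.exact_subtype_ker_map q
  have hpure : IsPureExact (LinearMap.ker q).subtype q := by
    refine ⟨isPureInjection_of_exists_lift (Submodule.injective_subtype _) hex ?_, hex,
      ULift.moduleEquiv.symm.surjective.comp hsurj⟩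
    intro E _ _ _ h
    obtain ⟨k, hk⟩ := hlift E (ULift.moduleEquiv.toLinearMap ∘ₗ h)
    refine ⟨k, ?_⟩
    rw [LinearMap.comp_assoc, hk]
    ext
    simp
  obtain ⟨s, hs⟩ := hM _ _ _ _ q hpure ULift.moduleEquiv.symm.toLinearMap
  exact ⟨I, F, _, _, hF, s, p, LinearMap.ext fun x =>
    ULift.moduleEquiv.symm.injective (LinearMap.congr_fun hs x)⟩

/-- Pure-projectivity is stable under base change. -/
theorem IsPureProjective.baseChange {M : Type w} [AddCommGroup M] [Module R M]
    (hM : IsPureProjective R M) (S : Type v) [CommRing S] [Algebra R S] :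
    IsPureProjective S (S ⊗[R] M) := by
  classical
  intro A B C _ _ _ _ _ _ f g hfg h
  obtain ⟨I, F, _, _, _, s, p, hps⟩ := hM.exists_retract
  let _ : Module R B := Module.compHom B (algebraMap R S)
  let _ : Module R C := Module.compHom C (algebraMap R S)
  have : IsScalarTower R S B := IsScalarTower.of_algebraMap_smul fun _ _ => rfl
  have : IsScalarTower R S C := IsScalarTower.of_algebraMap_smul fun _ _ => rfl
  have hlift (i : I) : ∃ k : S ⊗[R] F i →ₗ[S] B,
      g ∘ₗ k = h ∘ₗ p.baseChange S ∘ₗ (DFinsupp.lsingle i).baseChange S :=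
    hfg.pure.exists_lift_of_finitePresentation hfg.exact hfg.surjective _
  choose k hk using hlift
  -- Gluing `R`-linearly before extending scalars avoids commuting `S ⊗ -` with the direct sum.
  let k' : (Π₀ i, F i) →ₗ[R] B :=
    DFinsupp.lsum ℕ fun i => (k i).restrictScalars R ∘ₗ TensorProduct.mk R S (F i) 1
  have hk' : g ∘ₗ k'.liftBaseChange S = h ∘ₗ p.baseChange S := by
    refine TensorProduct.AlgebraTensorModule.curry_injective (LinearMap.ext_ring ?_)
    refine DFinsupp.lhom_ext' fun i => LinearMap.ext fun x => ?_
    have := LinearMap.congr_fun (hk i) (1 ⊗ₜ x)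
    simpa [k'] using this
  refine ⟨k'.liftBaseChange S ∘ₗ s.baseChange S, ?_⟩
  rw [← LinearMap.comp_assoc, hk', LinearMap.comp_assoc, ← LinearMap.baseChange_comp, hps,
    LinearMap.baseChange_id, LinearMap.comp_id]

/-- A faithfully flat algebra is a pure extension. -/
theorem isPureExtension_of_faithfullyFlat (S : Type v) [CommRing S] [Algebra R S]
    [Module.FaithfullyFlat R S] : IsPureExtension R S := by
  have h (X : Type u) [AddCommGroup X] [Module R X] :
      Function.Injective ((Algebra.linearMap R S).rTensor X) := by
    have h1 := Module.FaithfullyFlat.tensorProduct_mk_injective (A := R) (B := S) X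
    have : (Algebra.linearMap R S).rTensor X =
        TensorProduct.mk R S X 1 ∘ₗ (TensorProduct.lid R X).toLinearMap := by
      ext; simp
    rw [this]
    exact h1.comp (TensorProduct.lid R X).injective
  exact ⟨LinearMap.injective_of_rTensor_self (h R), fun X _ _ => h X⟩

/-- The completion of a noetherian local ring is a pure extension. -/
theorem isPureExtension_adicCompletion (R : Type u) [CommRing R] [IsLocalRing R]
    [IsNoetherianRing R] :
    IsPureExtension R (AdicCompletion (IsLocalRing.maximalIdeal R) R) := by
  have hfg : (IsLocalRing.maximalIdeal R).FG := IsNoetherian.noetherian _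
  have := AdicCompletion.isLocalRing_of_fg hfg
  have := AdicCompletion.algebraMap_isLocalHom_of_fg hfg
  have : Module.Flat R (AdicCompletion (IsLocalRing.maximalIdeal R) R) :=
    AdicCompletion.flat_of_isNoetherian _
  have := Module.FaithfullyFlat.of_flat_of_isLocalHom (A := R)
    (B := AdicCompletion (IsLocalRing.maximalIdeal R) R)
  exact isPureExtension_of_faithfullyFlat _

end Presentation

/-! ### Finitely presented stages over `M` -/

/-- A finitely presented module together with a linear map to `M`. -/
structure FPModuleOver (R : Type u) [CommRing R] (M : Type w) [AddCommGroup M] [Module R M] where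
  /-- The underlying type. -/
  carrier : Type u
  [addCommGroup : AddCommGroup carrier]
  [module : Module R carrier]
  [finitePresentation : Module.FinitePresentation R carrier]
  /-- The structure map to `M`. -/
  hom : carrier →ₗ[R] M

namespace FPModuleOver

attribute [instance] addCommGroup module finitePresentation

variable {R : Type u} [CommRing R] {M : Type w} [AddCommGroup M] [Module R M]

/-- An element of `X ⊗ W` that vanishes in `M ⊗ W` vanishes at a finitely presented stage. -/
theorem exists_rTensor_eq_zero (X : FPModuleOver R M) {W : Type*} [AddCommGroup W] [Module R W]
    (z : X.carrier ⊗[R] W) (hz : X.hom.rTensor W z = 0) :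
    ∃ (Y : FPModuleOver R M) (g : X.carrier →ₗ[R] Y.carrier),
      Y.hom ∘ₗ g = X.hom ∧ g.rTensor W z = 0 := by
  have hP : (LinearMap.range X.hom).FG := by simp
  have hz' : (LinearMap.range X.hom).subtype.rTensor W (X.hom.rangeRestrict.rTensor W z) = 0 := by
    rw [← LinearMap.comp_apply, ← LinearMap.rTensor_comp, LinearMap.subtype_comp_codRestrict, hz]
  obtain ⟨Q, hPQ, hQ, h⟩ := TensorProduct.eq_zero_of_fg_of_subtype_eq_zero hP hz'
  have : Module.Finite R Q := Module.Finite.iff_fg.2 hQ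
  obtain ⟨n, π, hπ⟩ := Module.Finite.exists_fin' R Q
  -- `Q` need not be finitely presented. It is covered by `X × R ^ n`, and a finitely generated part
  -- of the kernel suffices to kill `z`.
  let j : X.carrier →ₗ[R] Q := Submodule.inclusion hPQ ∘ₗ X.hom.rangeRestrict
  let q : X.carrier × (Fin n → R) →ₗ[R] Q := j.coprod π
  have hq : Function.Surjective q := fun y => by
    obtain ⟨x, rfl⟩ := hπ y
    exact ⟨(0, x), by simp [q]⟩
  have hzq : q.rTensor W ((LinearMap.inl R X.carrier (Fin n → R)).rTensor W z) = 0 := by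
    rw [← LinearMap.comp_apply, ← LinearMap.rTensor_comp, LinearMap.coprod_inl,
      LinearMap.rTensor_comp, LinearMap.comp_apply, h]
  obtain ⟨t, ht⟩ := (rTensor_exact W q.exact_subtype_ker_map hq _).1 hzq
  obtain ⟨K, hK, t, rfl⟩ := TensorProduct.exists_of_fg t
  let K' := K.map (LinearMap.ker q).subtype
  have hK' : K' ≤ LinearMap.ker q := Submodule.map_subtype_le _ _
  have := finitePresentation_quotient_of_fg (hK.map (LinearMap.ker q).subtype)
  refine ⟨⟨_ ⧸ K', K'.liftQ (Q.subtype ∘ₗ q) fun x hx => ?_⟩,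
    K'.mkQ ∘ₗ LinearMap.inl R X.carrier (Fin n → R), ?_, ?_⟩
  · have := hK' hx
    rw [LinearMap.mem_ker] at this
    simp [this]
  · ext x
    simp [q, j]
  · rw [LinearMap.rTensor_comp, LinearMap.comp_apply, ← ht]
    simp only [← LinearMap.comp_apply, ← LinearMap.rTensor_comp]
    have : (K'.mkQ ∘ₗ (LinearMap.ker q).subtype) ∘ₗ K.subtype = 0 := by
      refine LinearMap.ext fun x => ?_
      exact (Submodule.Quotient.mk_eq_zero _).2 ⟨x.1, x.2, rfl⟩
    rw [LinearMap.comp_assoc] at this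
    exact LinearMap.congr_fun (congr_arg (LinearMap.rTensor W) this) t |>.trans (by simp)

variable (S : Type v) [CommRing S] [Algebra R S]

/-- Finitely many elements of `S ⊗ X` that vanish in `S ⊗ M` vanish at a finitely presented
stage. -/
theorem exists_baseChange_eq_zero (X : FPModuleOver R M) {Z : Set (S ⊗[R] X.carrier)}
    (hZ : Z.Finite) (h : ∀ z ∈ Z, X.hom.baseChange S z = 0) :
    ∃ (Y : FPModuleOver R M) (g : X.carrier →ₗ[R] Y.carrier),
      Y.hom ∘ₗ g = X.hom ∧ ∀ z ∈ Z, g.baseChange S z = 0 := by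
  induction Z, hZ using Set.Finite.induction_on with
  | empty => exact ⟨X, LinearMap.id, by simp, by simp⟩
  | @insert a s _ _ ih =>
    obtain ⟨Y, g, hg, hY⟩ := ih fun z hz => h z (Set.mem_insert_of_mem _ hz)
    have ha : Y.hom.baseChange S (g.baseChange S a) = 0 := by
      rw [← LinearMap.comp_apply, ← LinearMap.baseChange_comp, hg]
      exact h a (Set.mem_insert _ _)
    obtain ⟨Y', g', hg', hY'⟩ := Y.exists_rTensor_eq_zero
      (TensorProduct.comm R S Y.carrier (g.baseChange S a)) (by
        exact (LinearMap.rTensor_comm Y.hom (g.baseChange S a)).trans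
          ((congr_arg _ ha).trans (map_zero _)))
    have ha' : g'.baseChange S (g.baseChange S a) = 0 := by
      apply (TensorProduct.comm R S Y'.carrier).injective
      exact ((LinearMap.rTensor_comm g' (g.baseChange S a)).symm.trans hY').trans (map_zero _).symm
    refine ⟨Y', g' ∘ₗ g, by rw [← LinearMap.comp_assoc, hg', hg], ?_⟩
    rintro z (rfl | hz)
    · rw [LinearMap.baseChange_comp, LinearMap.comp_apply, ha']
    · rw [LinearMap.baseChange_comp, LinearMap.comp_apply, hY z hz, map_zero]

/-- Finitely many elements of `S ⊗ M` come from a finitely presented stage. -/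
theorem exists_subset_range_baseChange (X : FPModuleOver R M) {Z : Set (S ⊗[R] M)}
    (hZ : Z.Finite) :
    ∃ (Y : FPModuleOver R M) (g : X.carrier →ₗ[R] Y.carrier),
      Y.hom ∘ₗ g = X.hom ∧ Z ⊆ LinearMap.range (Y.hom.baseChange S) := by
  obtain ⟨N, hN, hNZ⟩ := TensorProduct.exists_finite_submodule_right_of_setFinite Z hZ
  obtain ⟨n, π, hπ⟩ := Module.Finite.exists_fin' R N
  refine ⟨⟨X.carrier × (Fin n → R), X.hom.coprod (N.subtype ∘ₗ π)⟩, LinearMap.inl _ _ _,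
    LinearMap.coprod_inl _ _, fun z hz => ?_⟩
  obtain ⟨t, rfl⟩ := hNZ hz
  obtain ⟨t, rfl⟩ := LinearMap.lTensor_surjective S hπ t
  refine ⟨(LinearMap.inr R X.carrier (Fin n → R)).baseChange S t, ?_⟩
  rw [← LinearMap.comp_apply, ← LinearMap.baseChange_comp, LinearMap.coprod_inr,
    LinearMap.baseChange_comp]
  rfl

/-- A map from a finitely presented `S`-module to `S ⊗ M` factors through a finitely presented
stage, compatibly with a given stage. -/
theorem exists_factor_baseChange (X : FPModuleOver R M) {Q : Type*} [AddCommGroup Q] [Module S Q]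
    [Module.FinitePresentation S Q] (a : S ⊗[R] X.carrier →ₗ[S] Q) (b : Q →ₗ[S] S ⊗[R] M)
    (hab : b ∘ₗ a = X.hom.baseChange S) :
    ∃ (Y : FPModuleOver R M) (g : X.carrier →ₗ[R] Y.carrier) (c : Q →ₗ[S] S ⊗[R] Y.carrier),
      Y.hom ∘ₗ g = X.hom ∧ c ∘ₗ a = g.baseChange S ∧ Y.hom.baseChange S ∘ₗ c = b := by
  classical
  obtain ⟨n, m, π, rel, hπ, hex⟩ := Module.FinitePresentation.exists_fin' S Q
  obtain ⟨Y, g, hg, hY⟩ := X.exists_subset_range_baseChange S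
    (Set.finite_range fun j : Fin n => b (π (Pi.single j 1)))
  choose y hy using fun j => hY (Set.mem_range_self j)
  let c₀ : (Fin n → S) →ₗ[S] S ⊗[R] Y.carrier := Fintype.linearCombination S y
  have hc₀ : Y.hom.baseChange S ∘ₗ c₀ = b ∘ₗ π := by
    refine LinearMap.pi_ext' fun j => LinearMap.ext_ring ?_
    simpa [c₀] using hy j
  obtain ⟨G, hG⟩ := Module.Finite.fg_top (R := S) (M := S ⊗[R] X.carrier)
  choose σ hσ using hπ
  -- Two finite sets die in `S ⊗ M`: the images of the relations of `Q`, and the differences between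
  -- `c₀ ∘ σ ∘ a` and `g` on generators of `S ⊗ X`. Killing the first lets `c₀` descend to `Q`;
  -- killing the second makes it compatible with `g`.
  obtain ⟨Y', g', hg', hY'⟩ := Y.exists_baseChange_eq_zero S
    (Z := Set.range (fun l : Fin m => c₀ (rel (Pi.single l 1))) ∪
      (fun x => c₀ (σ (a x)) - g.baseChange S x) '' G)
    ((Set.finite_range _).union (G.finite_toSet.image _)) (by
      rintro _ (⟨l, rfl⟩ | ⟨x, -, rfl⟩)
      · dsimp only
        rw [← LinearMap.comp_apply, hc₀, LinearMap.comp_apply, hex.apply_apply_eq_zero, map_zero]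
      · dsimp only
        rw [map_sub, ← LinearMap.comp_apply, hc₀, LinearMap.comp_apply, hσ, sub_eq_zero,
          ← LinearMap.comp_apply, hab, ← LinearMap.comp_apply, ← LinearMap.baseChange_comp, hg])
  obtain ⟨c, hc⟩ := π.exists_comp_eq_of_ker_le (fun x => ⟨σ x, hσ x⟩) (g'.baseChange S ∘ₗ c₀) (by
    rw [hex.linearMap_ker_eq]
    rintro _ ⟨x, rfl⟩
    have : (g'.baseChange S ∘ₗ c₀) ∘ₗ rel = 0 := by
      refine LinearMap.pi_ext' fun l => LinearMap.ext_ring ?_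
      simpa using hY' _ (Or.inl ⟨l, rfl⟩)
    simpa using LinearMap.congr_fun this x)
  refine ⟨Y', g' ∘ₗ g, c, by rw [← LinearMap.comp_assoc, hg', hg], ?_, ?_⟩
  · refine LinearMap.ext_on hG fun x hx => ?_
    have h1 := hY' _ (Or.inr ⟨x, hx, rfl⟩)
    rw [map_sub, sub_eq_zero] at h1
    rw [LinearMap.baseChange_comp, LinearMap.comp_apply, LinearMap.comp_apply, ← h1, ← hσ (a x),
      ← LinearMap.comp_apply, hc, hσ, LinearMap.comp_apply]
  · rw [← LinearMap.cancel_right (fun x => ⟨σ x, hσ x⟩ : Function.Surjective π),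
      LinearMap.comp_assoc, hc, ← LinearMap.comp_assoc, ← LinearMap.baseChange_comp, hg', hc₀]

/-- Given a presentation of `S ⊗ M` as a retract of a direct sum of finitely presented modules,
each stage `X` maps to a stage `Y` such that the base change of `X → Y` extends to `S ⊗ M`, and the
summands met by `X` map to the image of `S ⊗ Y`. -/
theorem exists_extension_of_retract {S} [CommRing S] [Algebra R S] {I : Type*} [DecidableEq I]
    {F : I → Type v} [∀ i, AddCommGroup (F i)] [∀ i, Module S (F i)]
    [∀ i, Module.FinitePresentation S (F i)] {s : S ⊗[R] M →ₗ[S] Π₀ i, F i}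
    {p : (Π₀ i, F i) →ₗ[S] S ⊗[R] M} (hps : p ∘ₗ s = LinearMap.id) (X : FPModuleOver R M) :
    ∃ (Y : FPModuleOver R M) (g : X.carrier →ₗ[R] Y.carrier) (T : Set I)
      (δ : S ⊗[R] M →ₗ[S] S ⊗[R] Y.carrier),
      Y.hom ∘ₗ g = X.hom ∧ δ ∘ₗ X.hom.baseChange S = g.baseChange S ∧
      (∀ x, ∀ i ∉ T, s (1 ⊗ₜ X.hom x) i = 0) ∧
      ∀ i ∈ T, ∀ v, p (DFinsupp.single i v) ∈ LinearMap.range (Y.hom.baseChange S) := by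
  classical
  obtain ⟨G, hG⟩ := Module.Finite.fg_top (R := S) (M := S ⊗[R] X.carrier)
  let T : Finset I := G.biUnion fun x => (s (X.hom.baseChange S x)).support
  let res : (Π₀ i, F i) →ₗ[S] (∀ i : T, F i) := LinearMap.pi fun i => DFinsupp.lapply i.1
  let inc : (∀ i : T, F i) →ₗ[S] Π₀ i, F i :=
    ∑ i : T, DFinsupp.lsingle i.1 ∘ₗ LinearMap.proj i
  have hT (x : S ⊗[R] X.carrier) : ∀ i ∉ T, s (X.hom.baseChange S x) i = 0 := by
    intro i hi
    have : DFinsupp.lapply i ∘ₗ s ∘ₗ X.hom.baseChange S = 0 := by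
      refine LinearMap.ext_on hG fun x hx => ?_
      by_contra h
      exact hi (Finset.mem_biUnion.2 ⟨x, hx, by simpa using h⟩)
    exact LinearMap.congr_fun this x
  have hinc (y : Π₀ i, F i) (hy : ∀ i ∉ T, y i = 0) : inc (res y) = y := by
    ext i
    by_cases hi : i ∈ T
    · simp only [inc, res, LinearMap.sum_apply, DFinsupp.finsetSum_apply]
      rw [Finset.sum_eq_single ⟨i, hi⟩]
      · simp
      · rintro ⟨j, hj⟩ - hji
        exact DFinsupp.single_eq_of_ne (fun h => hji (Subtype.ext h.symm))
      · simp
    · simp only [inc, res, LinearMap.sum_apply, DFinsupp.finsetSum_apply, hy i hi]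
      refine Finset.sum_eq_zero fun j _ => ?_
      exact DFinsupp.single_eq_of_ne (by rintro rfl; exact hi j.2)
  -- The sum over the finite set `T` is finitely presented, and `S ⊗ X → S ⊗ M` factors through it
  -- because `p ∘ s = id`.
  obtain ⟨Y, g, c, hg, hca, hcb⟩ := X.exists_factor_baseChange S
    (res ∘ₗ s ∘ₗ X.hom.baseChange S) (p ∘ₗ inc) (LinearMap.ext fun x => by
      simp only [LinearMap.comp_apply]
      rw [hinc _ (hT x), ← LinearMap.comp_apply, hps, LinearMap.id_apply])
  refine ⟨Y, g, T, c ∘ₗ res ∘ₗ s, hg, hca, fun x i hi => ?_, fun i hi v => ?_⟩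
  · simpa using hT (1 ⊗ₜ x) i hi
  · refine ⟨c (res (DFinsupp.single i v)), ?_⟩
    rw [← LinearMap.comp_apply, hcb, LinearMap.comp_apply, hinc]
    intro k hk
    exact DFinsupp.single_eq_of_ne (by rintro rfl; exact hk hi)

end FPModuleOver

/-! ### Countable towers and their pure-projective unions -/

section Tower

variable {R : Type u} [CommRing R] {M : Type w} [AddCommGroup M] [Module R M]

/-- If the base change of `g` along a pure extension factors through the base change of `φ`, then
the tensor kernels of `φ` are contained in those of `g`. -/
theorem IsPureExtension.ker_rTensor_le {S : Type v} [CommRing S] [Algebra R S]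
    (hS : IsPureExtension R S) {E E' : Type u} [AddCommGroup E] [Module R E] [AddCommGroup E']
    [Module R E'] {φ : E →ₗ[R] M} {g : E →ₗ[R] E'} {δ : S ⊗[R] M →ₗ[R] S ⊗[R] E'}
    (hδ : δ ∘ₗ φ.lTensor S = g.lTensor S) (W : Type u) [AddCommGroup W] [Module R W] :
    LinearMap.ker (φ.rTensor W) ≤ LinearMap.ker (g.rTensor W) := by
  intro z hz
  -- Up to associativity this is `R → S` tensored with `E' ⊗ W`.
  have hinj : Function.Injective ((TensorProduct.mk R S E' 1).rTensor W) := by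
    have : (TensorProduct.mk R S E' 1).rTensor W =
        (TensorProduct.assoc R S E' W).symm.toLinearMap ∘ₗ
          (Algebra.linearMap R S).rTensor (E' ⊗[R] W) ∘ₗ
            (TensorProduct.lid R (E' ⊗[R] W)).symm.toLinearMap := by
      ext
      simp
    rw [this]
    exact (TensorProduct.assoc R S E' W).symm.injective.comp
      ((hS.rTensor_injective (E' ⊗[R] W)).comp (TensorProduct.lid R (E' ⊗[R] W)).symm.injective)
  have hg : TensorProduct.mk R S E' 1 ∘ₗ g = δ ∘ₗ TensorProduct.mk R S M 1 ∘ₗ φ := by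
    ext x
    simpa using (LinearMap.congr_fun hδ (1 ⊗ₜ x)).symm
  apply hinj
  rw [LinearMap.mem_ker] at hz
  rw [← LinearMap.comp_apply, ← LinearMap.rTensor_comp, hg, LinearMap.rTensor_comp,
    LinearMap.rTensor_comp, LinearMap.comp_apply, LinearMap.comp_apply, hz]
  simp

/-- A sequence of finitely presented modules over `M`, each capturing the tensor kernels of its
predecessor. -/
structure FPTower (R : Type u) [CommRing R] (M : Type w) [AddCommGroup M] [Module R M] where
  /-- The stages. -/
  X : ℕ → FPModuleOver R M
  /-- The transition maps. -/
  t : ∀ n, (X n).carrier →ₗ[R] (X (n + 1)).carrier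
  hom_comp : ∀ n, (X (n + 1)).hom ∘ₗ t n = (X n).hom
  ker_le : ∀ (n : ℕ) (W : Type u) [AddCommGroup W] [Module R W],
    LinearMap.ker ((X n).hom.rTensor W) ≤ LinearMap.ker ((t n).rTensor W)

namespace FPTower

variable (𝒯 : FPTower R M)

/-- The union of the images of the stages. -/
def union : Submodule R M := ⨆ n, LinearMap.range (𝒯.X n).hom

/-- The map from a stage to the union. -/
def toUnion (n : ℕ) : (𝒯.X n).carrier →ₗ[R] 𝒯.union :=
  (𝒯.X n).hom.codRestrict 𝒯.union fun x =>
    Submodule.mem_iSup_of_mem n (LinearMap.mem_range_self _ x)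

theorem subtype_comp_toUnion (n : ℕ) : 𝒯.union.subtype ∘ₗ 𝒯.toUnion n = (𝒯.X n).hom :=
  LinearMap.subtype_comp_codRestrict _ _ _

theorem toUnion_comp (n : ℕ) : 𝒯.toUnion (n + 1) ∘ₗ 𝒯.t n = 𝒯.toUnion n :=
  LinearMap.ext fun x => Subtype.ext (LinearMap.congr_fun (𝒯.hom_comp n) x)

theorem monotone_range_of_comp_eq {N : Type*} [AddCommGroup N] [Module R N]
    {Y : ℕ → Type*} [∀ n, AddCommGroup (Y n)] [∀ n, Module R (Y n)]
    {t : ∀ n, Y n →ₗ[R] Y (n + 1)} {k : ∀ n, Y n →ₗ[R] N} (h : ∀ n, k (n + 1) ∘ₗ t n = k n) :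
    Monotone fun n => LinearMap.range (k n) :=
  monotone_nat_of_le_succ fun n => by
    rw [← h n]
    exact LinearMap.range_comp_le_range _ _

theorem exists_hom_eq {x : M} (hx : x ∈ 𝒯.union) : ∃ n y, (𝒯.X n).hom y = x :=
  (Submodule.mem_iSup_of_directed _
    (monotone_range_of_comp_eq 𝒯.hom_comp).directed_le).1 hx

theorem exists_toUnion_eq (x : 𝒯.union) : ∃ n y, 𝒯.toUnion n y = x := by
  obtain ⟨n, y, h⟩ := 𝒯.exists_hom_eq x.2
  exact ⟨n, y, Subtype.ext h⟩

/-- A tensor over the union comes from some stage; if it dies over `M`, then `ker_le` kills it at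
the next stage. -/
theorem isPureInjection_subtype_union : IsPureInjection 𝒯.union.subtype := by
  refine ⟨Submodule.injective_subtype _, fun W _ _ => ?_⟩
  rw [injective_iff_map_eq_zero]
  intro z hz
  have hmono := monotone_range_of_comp_eq (t := fun n => (𝒯.t n).rTensor W)
    (k := fun n => (𝒯.toUnion n).rTensor W)
    (fun n => by rw [← LinearMap.rTensor_comp, toUnion_comp])
  have hmem : z ∈ ⨆ n, LinearMap.range ((𝒯.toUnion n).rTensor W) := by
    clear hz
    induction z with
    | zero => exact zero_mem _
    | tmul x y =>
      obtain ⟨n, x, rfl⟩ := 𝒯.exists_toUnion_eq x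
      exact Submodule.mem_iSup_of_mem n ⟨x ⊗ₜ y, by simp⟩
    | add x y hx hy => exact add_mem hx hy
  obtain ⟨n, y, rfl⟩ := (Submodule.mem_iSup_of_directed _ hmono.directed_le).1 hmem
  rw [← LinearMap.comp_apply, ← LinearMap.rTensor_comp, subtype_comp_toUnion] at hz
  have := 𝒯.ker_le n W hz
  rw [LinearMap.mem_ker] at this
  rw [← toUnion_comp, LinearMap.rTensor_comp, LinearMap.comp_apply, this, map_zero]

theorem ker_hom_le (n : ℕ) : LinearMap.ker (𝒯.X n).hom ≤ LinearMap.ker (𝒯.t n) := by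
  intro x hx
  have h : x ⊗ₜ[R] (1 : R) ∈ LinearMap.ker ((𝒯.t n).rTensor R) :=
    𝒯.ker_le n R (by simp [LinearMap.mem_ker.1 hx])
  simpa using congr_arg (TensorProduct.rid R _) (LinearMap.mem_ker.1 h)

/-- Compatible maps on the stages glue to a map on the union. -/
theorem exists_glue {B : Type*} [AddCommGroup B] [Module R B]
    (k : ∀ n, (𝒯.X n).carrier →ₗ[R] B) (hk : ∀ n, k (n + 1) ∘ₗ 𝒯.t n = k n) :
    ∃ l : 𝒯.union →ₗ[R] B, ∀ n, l ∘ₗ 𝒯.toUnion n = k n := by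
  let q : (Π₀ n, (𝒯.X n).carrier) →ₗ[R] 𝒯.union := DFinsupp.lsum ℕ 𝒯.toUnion
  let k' : (Π₀ n, (𝒯.X n).carrier) →ₗ[R] B := DFinsupp.lsum ℕ k
  have hq : Function.Surjective q := fun x => by
    obtain ⟨n, y, rfl⟩ := 𝒯.exists_toUnion_eq x
    exact ⟨DFinsupp.single n y, by simp [q]⟩
  -- For `x` in the kernel of `q`, the pair `(q x, k' x)` comes from one stage, at an element dying
  -- in `M`. The next transition kills that element, so `k' x = 0`.
  have hmono := monotone_range_of_comp_eq (t := 𝒯.t) (k := fun n => (𝒯.toUnion n).prod (k n))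
    (fun n => by rw [LinearMap.prod_comp, toUnion_comp, hk])
  have hmem (x : Π₀ n, (𝒯.X n).carrier) :
      (q x, k' x) ∈ ⨆ n, LinearMap.range ((𝒯.toUnion n).prod (k n)) := by
    induction x using DFinsupp.induction with
    | h0 =>
      rw [map_zero, map_zero]
      exact zero_mem _
    | ha n y x _ _ hx =>
      rw [map_add, map_add, ← Prod.mk_add_mk]
      refine add_mem (Submodule.mem_iSup_of_mem n ⟨y, ?_⟩) hx
      simp [q, k']
  obtain ⟨l, hl⟩ := q.exists_comp_eq_of_ker_le hq k' fun x hx => by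
    obtain ⟨n, y, hy⟩ := (Submodule.mem_iSup_of_directed _ hmono.directed_le).1 (hmem x)
    obtain ⟨h1, h2⟩ := Prod.ext_iff.1 hy
    have hy0 : y ∈ LinearMap.ker (𝒯.X n).hom :=
      congr_arg Subtype.val (h1.trans (LinearMap.mem_ker.1 hx))
    have := 𝒯.ker_hom_le n hy0
    rw [LinearMap.mem_ker] at this ⊢
    rw [← show k n y = k' x from h2, ← hk, LinearMap.comp_apply, this, map_zero]
  refine ⟨l, fun n => LinearMap.ext fun y => ?_⟩
  simpa [q, k'] using LinearMap.congr_fun hl (DFinsupp.single n y)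

/-- The tensor kernels of the two-step transition lie in those of the map to `M`, hence in those of
`t n`. -/
theorem exists_retract_comp (n : ℕ) : ∃ r : (𝒯.X (n + 2)).carrier →ₗ[R] (𝒯.X (n + 1)).carrier,
    r ∘ₗ 𝒯.t (n + 1) ∘ₗ 𝒯.t n = 𝒯.t n :=
  exists_comp_eq_of_ker_rTensor_le _ _ fun W _ _ z hz => by
    apply 𝒯.ker_le n W
    rw [LinearMap.mem_ker] at hz ⊢
    rw [← 𝒯.hom_comp n, ← 𝒯.hom_comp (n + 1), LinearMap.comp_assoc, LinearMap.rTensor_comp,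
      LinearMap.comp_apply, hz, map_zero]

/-- Each stage lifts, but not compatibly. The discrepancy between a lift at stage `n + 2` and a
given one at stage `n + 1` has values in the kernel of `g`; composing it with the map `r` of
`exists_retract_comp` corrects the new lift so that the two agree on the image of stage `n`. -/
theorem isPureProjective_union : IsPureProjective R 𝒯.union := by
  intro A B C _ _ _ _ _ _ f g hfg h
  let Lift (n : ℕ) := {k : (𝒯.X n).carrier →ₗ[R] B // g ∘ₗ k = h ∘ₗ 𝒯.toUnion n}
  have hlift (n : ℕ) : Nonempty (Lift n) := by
    obtain ⟨k, hk⟩ := hfg.pure.exists_lift_of_finitePresentation hfg.exact hfg.surjective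
      (h ∘ₗ 𝒯.toUnion n)
    exact ⟨⟨k, hk⟩⟩
  have hstep (n : ℕ) (k : Lift (n + 1)) :
      ∃ k' : Lift (n + 2), k'.1 ∘ₗ 𝒯.t (n + 1) ∘ₗ 𝒯.t n = k.1 ∘ₗ 𝒯.t n := by
    obtain ⟨k', hk'⟩ := hlift (n + 2)
    obtain ⟨r, hr⟩ := 𝒯.exists_retract_comp n
    have hd : g ∘ₗ (k' ∘ₗ 𝒯.t (n + 1) - k.1) = 0 := by
      rw [LinearMap.comp_sub, ← LinearMap.comp_assoc, hk', k.2, LinearMap.comp_assoc,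
        toUnion_comp, sub_self]
    refine ⟨⟨k' - (k' ∘ₗ 𝒯.t (n + 1) - k.1) ∘ₗ r, ?_⟩, ?_⟩
    · rw [LinearMap.comp_sub, ← LinearMap.comp_assoc, hd, LinearMap.zero_comp, sub_zero, hk']
    · rw [LinearMap.sub_comp, LinearMap.comp_assoc, hr, LinearMap.sub_comp, LinearMap.comp_assoc,
        sub_sub_cancel]
  choose next hnext using hstep
  -- The shift is needed: only the composites `K n ∘ t n` are compatible, not the lifts `K n`.
  let K (n : ℕ) : Lift (n + 1) := Nat.rec (hlift 1).some next n
  obtain ⟨l, hl⟩ := 𝒯.exists_glue (fun n => (K n).1 ∘ₗ 𝒯.t n) fun n => by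
    rw [LinearMap.comp_assoc]
    exact hnext n (K n)
  refine ⟨l, LinearMap.ext fun x => ?_⟩
  obtain ⟨n, y, rfl⟩ := 𝒯.exists_toUnion_eq x
  rw [LinearMap.comp_apply, ← LinearMap.comp_apply l, hl, ← LinearMap.comp_apply,
    ← LinearMap.comp_assoc, (K n).2, LinearMap.comp_assoc, toUnion_comp, LinearMap.comp_apply]

end FPTower

/-- Let `S ⊗ M` be a retract of a direct sum of finitely presented `S`-modules, for a pure
extension `S` of `R`. Every element of `M` lies in a pure, pure-projective submodule whose base
change is compatible with a subset of the summands. -/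
theorem IsPureExtension.exists_isPureProjective_submodule {S : Type v} [CommRing S] [Algebra R S]
    (hS : IsPureExtension R S) {I : Type*} [DecidableEq I] {F : I → Type v}
    [∀ i, AddCommGroup (F i)] [∀ i, Module S (F i)] [∀ i, Module.FinitePresentation S (F i)]
    {s : S ⊗[R] M →ₗ[S] Π₀ i, F i} {p : (Π₀ i, F i) →ₗ[S] S ⊗[R] M}
    (hps : p ∘ₗ s = LinearMap.id) (x : M) :
    ∃ (N : Submodule R M) (J : Set I), x ∈ N ∧ IsPureInjection N.subtype ∧
      IsPureProjective R N ∧ (∀ y ∈ N, ∀ i ∉ J, s (1 ⊗ₜ y) i = 0) ∧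
      ∀ i ∈ J, ∀ v, p (DFinsupp.single i v) ∈ LinearMap.range (N.subtype.baseChange S) := by
  choose next g T δ hg hδ hT hp using FPModuleOver.exists_extension_of_retract hps
  have hker (Y : FPModuleOver R M) (W : Type u) [AddCommGroup W] [Module R W] :
      LinearMap.ker (Y.hom.rTensor W) ≤ LinearMap.ker ((g Y).rTensor W) :=
    hS.ker_rTensor_le (δ := (δ Y).restrictScalars R)
      (LinearMap.ext fun z => LinearMap.congr_fun (hδ Y) z) W
  let X₀ : FPModuleOver R M := ⟨R, LinearMap.toSpanSingleton R M x⟩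
  let X (n : ℕ) : FPModuleOver R M := Nat.rec X₀ (fun _ Y => next Y) n
  let 𝒯 : FPTower R M :=
    { X := X
      t := fun n => g (X n)
      hom_comp := fun n => hg (X n)
      ker_le := fun n W _ _ => hker (X n) W }
  -- The summands met by one stage are mapped by `p` into the image of the next, so the union is
  -- closed under both conditions.
  refine ⟨𝒯.union, ⋃ n, T (X n), ?_, 𝒯.isPureInjection_subtype_union, 𝒯.isPureProjective_union,
    fun y hy i hi => ?_, fun i hi v => ?_⟩
  · exact Submodule.mem_iSup_of_mem 0 ⟨(1 : R), by simp [𝒯, X, X₀]⟩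
  · obtain ⟨n, y, rfl⟩ := 𝒯.exists_hom_eq hy
    exact hT (X n) y i fun h => hi (Set.mem_iUnion.2 ⟨n, h⟩)
  · obtain ⟨n, hn⟩ := Set.mem_iUnion.1 hi
    have := hp (X n) i hn v
    rw [show (next (X n)).hom = 𝒯.union.subtype ∘ₗ 𝒯.toUnion (n + 1) from
      (𝒯.subtype_comp_toUnion (n + 1)).symm, LinearMap.baseChange_comp] at this
    exact LinearMap.range_comp_le_range _ _ this

end Tower

/-! ### Adapted submodules and descent by Zorn's lemma -/

section Descent

variable {R : Type u} [CommRing R] {M : Type w} [AddCommGroup M] [Module R M]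

/-- Pure-projective modules lift along pure epimorphisms in all universes. -/
theorem IsPureProjective.exists_lift (hM : IsPureProjective R M) {A B C : Type*}
    [AddCommGroup A] [Module R A] [AddCommGroup B] [Module R B] [AddCommGroup C] [Module R C]
    {f : A →ₗ[R] B} {g : B →ₗ[R] C} (hf : IsPureInjection f) (hfg : Function.Exact f g)
    (hg : Function.Surjective g) (h : M →ₗ[R] C) : ∃ k : M →ₗ[R] B, g ∘ₗ k = h := by
  classical
  obtain ⟨I, F, _, _, _, s, p, hps⟩ := hM.exists_retract
  have hlift (i : I) : ∃ k : F i →ₗ[R] B, g ∘ₗ k = h ∘ₗ p ∘ₗ DFinsupp.lsingle i :=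
    hf.exists_lift_of_finitePresentation hfg hg _
  choose k hk using hlift
  have hk' : g ∘ₗ DFinsupp.lsum ℕ k = h ∘ₗ p := by
    refine DFinsupp.lhom_ext' fun i => LinearMap.ext fun x => ?_
    simpa using LinearMap.congr_fun (hk i) x
  exact ⟨DFinsupp.lsum ℕ k ∘ₗ s, by
    rw [← LinearMap.comp_assoc, hk', LinearMap.comp_assoc, hps, LinearMap.comp_id]⟩

theorem isPureInjection_subtype_bot : IsPureInjection (⊥ : Submodule R M).subtype := by
  refine ⟨Submodule.injective_subtype _, fun W _ _ => ?_⟩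
  rw [injective_iff_map_eq_zero]
  rintro z -
  induction z with
  | zero => rfl
  | tmul x y => rw [Subsingleton.elim x 0, TensorProduct.zero_tmul]
  | add x y hx hy => rw [hx, hy, add_zero]

/-- A directed union of pure submodules is pure. -/
theorem isPureInjection_subtype_iSup {ι : Type*} [Nonempty ι] {N : ι → Submodule R M}
    (hdir : Directed (· ≤ ·) N) (hN : ∀ i, IsPureInjection (N i).subtype) :
    IsPureInjection (⨆ i, N i).subtype := by
  refine ⟨Submodule.injective_subtype _, fun W _ _ => ?_⟩
  rw [injective_iff_map_eq_zero]
  intro z hz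
  let j (i : ι) : N i →ₗ[R] (⨆ i, N i : Submodule R M) := Submodule.inclusion (le_iSup N i)
  have hdir' : Directed (· ≤ ·) fun i => LinearMap.range ((j i).rTensor W) := by
    intro a b
    obtain ⟨c, hac, hbc⟩ := hdir a b
    have hle {a : ι} (h : N a ≤ N c) :
        LinearMap.range ((j a).rTensor W) ≤ LinearMap.range ((j c).rTensor W) := by
      rw [show j a = j c ∘ₗ Submodule.inclusion h from rfl, LinearMap.rTensor_comp]
      exact LinearMap.range_comp_le_range _ _
    exact ⟨c, hle hac, hle hbc⟩
  have hmem : z ∈ ⨆ i, LinearMap.range ((j i).rTensor W) := by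
    clear hz
    induction z with
    | zero => exact zero_mem _
    | tmul x y =>
      obtain ⟨i, hi⟩ := (Submodule.mem_iSup_of_directed _ hdir).1 x.2
      exact Submodule.mem_iSup_of_mem i ⟨⟨x, hi⟩ ⊗ₜ y, rfl⟩
    | add x y hx hy => exact add_mem hx hy
  obtain ⟨i, y, rfl⟩ := (Submodule.mem_iSup_of_directed _ hdir').1 hmem
  rw [← LinearMap.comp_apply, ← LinearMap.rTensor_comp, Submodule.subtype_comp_inclusion] at hz
  rw [(hN i).rTensor_injective W (hz.trans (map_zero _).symm), map_zero]

section Comap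

variable {N : Submodule R M} (N' : Submodule R (M ⧸ N))

/-- The projection from the preimage of a submodule of a quotient. -/
def comapMkQ : N'.comap N.mkQ →ₗ[R] N' := N.mkQ.restrict fun _ h => h

theorem subtype_comp_comapMkQ :
    N'.subtype ∘ₗ comapMkQ N' = N.mkQ ∘ₗ (N'.comap N.mkQ).subtype := rfl

theorem comapMkQ_surjective : Function.Surjective (comapMkQ N') := by
  rintro ⟨y, hy⟩
  obtain ⟨x, rfl⟩ := N.mkQ_surjective y
  exact ⟨⟨x, hy⟩, rfl⟩

theorem exact_inclusion_comapMkQ :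
    Function.Exact (Submodule.inclusion (Submodule.le_comap_mkQ N N')) (comapMkQ N') := by
  intro x
  constructor
  · intro h
    have hx : x.1 ∈ N := (Submodule.Quotient.mk_eq_zero N).1 (congr_arg Subtype.val h)
    exact ⟨⟨x.1, hx⟩, rfl⟩
  · rintro ⟨y, rfl⟩
    exact Subtype.ext ((Submodule.Quotient.mk_eq_zero N).2 y.2)

variable {N'}

/-- The preimage of a pure submodule of the quotient by a pure submodule is pure. -/
theorem IsPureInjection.subtype_comap_mkQ (hN : IsPureInjection N.subtype)
    (hN' : IsPureInjection N'.subtype) : IsPureInjection (N'.comap N.mkQ).subtype := by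
  refine ⟨Submodule.injective_subtype _, fun W _ _ => ?_⟩
  rw [injective_iff_map_eq_zero]
  intro z hz
  have h1 : (comapMkQ N').rTensor W z = 0 := by
    apply hN'.rTensor_injective W
    rw [← LinearMap.comp_apply, ← LinearMap.rTensor_comp, subtype_comp_comapMkQ,
      LinearMap.rTensor_comp, LinearMap.comp_apply, hz, map_zero, map_zero]
  obtain ⟨y, rfl⟩ :=
    (rTensor_exact W (exact_inclusion_comapMkQ N') (comapMkQ_surjective N') _).1 h1
  rw [← LinearMap.comp_apply, ← LinearMap.rTensor_comp, Submodule.subtype_comp_inclusion] at hz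
  rw [hN.rTensor_injective W (hz.trans (map_zero _).symm), map_zero]

theorem IsPureInjection.inclusion (hN : IsPureInjection N.subtype) {N₁ : Submodule R M}
    (h : N ≤ N₁) : IsPureInjection (Submodule.inclusion h) := by
  refine ⟨Submodule.inclusion_injective h, fun W _ _ => ?_⟩
  have := hN.rTensor_injective W
  rw [← Submodule.subtype_comp_inclusion _ _ h, LinearMap.rTensor_comp] at this
  exact Function.Injective.of_comp this

/-- Partial lifts along a pure epimorphism extend from a pure submodule to the preimage of a
pure-projective submodule of the quotient. -/
theorem IsPureInjection.exists_extend_lift (hN : IsPureInjection N.subtype)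
    (hN' : IsPureProjective R N') {A B C : Type*}
    [AddCommGroup A] [Module R A] [AddCommGroup B] [Module R B] [AddCommGroup C] [Module R C]
    {f : A →ₗ[R] B} {g : B →ₗ[R] C} (hf : IsPureInjection f) (hfg : Function.Exact f g)
    (hg : Function.Surjective g) (h : M →ₗ[R] C) (k : N →ₗ[R] B) (hk : g ∘ₗ k = h ∘ₗ N.subtype) :
    ∃ k' : N'.comap N.mkQ →ₗ[R] B, g ∘ₗ k' = h ∘ₗ (N'.comap N.mkQ).subtype ∧
      k' ∘ₗ Submodule.inclusion (Submodule.le_comap_mkQ N N') = k := by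
  set j := Submodule.inclusion (Submodule.le_comap_mkQ N N')
  have hj : IsPureInjection j := hN.inclusion _
  have hex : Function.Exact j (comapMkQ N') := exact_inclusion_comapMkQ N'
  -- The extension of `N'` by `N` splits. The error of `k ∘ ρ` as a lift vanishes on `N`, so it
  -- factors through `N'`, where it lifts along `g`.
  obtain ⟨σ, hσ⟩ := hN'.exists_lift hj hex (comapMkQ_surjective N') LinearMap.id
  obtain ⟨-, ρ, hρ⟩ : Function.Surjective (comapMkQ N') ∧ ∃ ρ, ρ ∘ₗ j = LinearMap.id :=
    (hex.split_tfae'.out 0 1 rfl rfl).1 ⟨hj.injective, σ, hσ⟩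
  obtain ⟨e, he⟩ := (comapMkQ N').exists_comp_eq_of_ker_le (comapMkQ_surjective N')
    (h ∘ₗ (N'.comap N.mkQ).subtype - g ∘ₗ k ∘ₗ ρ) (by
      rw [hex.linearMap_ker_eq]
      rintro _ ⟨x, rfl⟩
      have h1 : ρ (j x) = x := LinearMap.congr_fun hρ x
      have h2 : g (k x) = h x := LinearMap.congr_fun hk x
      simp [h1, h2, j])
  obtain ⟨b, hb⟩ := hN'.exists_lift hf hfg hg e
  refine ⟨k ∘ₗ ρ + b ∘ₗ comapMkQ N', ?_, ?_⟩
  · rw [LinearMap.comp_add, ← LinearMap.comp_assoc _ b g, hb, he]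
    abel
  · rw [LinearMap.add_comp, LinearMap.comp_assoc, hρ, LinearMap.comp_assoc,
      hex.linearMap_comp_eq_zero, LinearMap.comp_zero, add_zero, LinearMap.comp_id]

end Comap

variable {S : Type v} [CommRing S] [Algebra R S] {I : Type*} [DecidableEq I] {F : I → Type v}
  [∀ i, AddCommGroup (F i)] [∀ i, Module S (F i)]

/-- A pure submodule `N` of `M` is adapted to a set `J` of summands of a direct sum with
maps `s`, `p` from and to `S ⊗ M` if `s` maps `N` to the summands in `J`, and `p` maps these to the
image of `S ⊗ N`. -/
structure IsAdapted (s : S ⊗[R] M →ₗ[S] Π₀ i, F i) (p : (Π₀ i, F i) →ₗ[S] S ⊗[R] M)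
    (N : Submodule R M) (J : Set I) : Prop where
  pure : IsPureInjection N.subtype
  apply_eq_zero : ∀ y ∈ N, ∀ i ∉ J, s (1 ⊗ₜ y) i = 0
  single_mem_range : ∀ i ∈ J, ∀ v,
    p (DFinsupp.single i v) ∈ LinearMap.range (N.subtype.baseChange S)

variable {s : S ⊗[R] M →ₗ[S] Π₀ i, F i} {p : (Π₀ i, F i) →ₗ[S] S ⊗[R] M}

theorem isAdapted_bot : IsAdapted s p ⊥ ∅ :=
  ⟨isPureInjection_subtype_bot, fun y hy i _ => by simp [(Submodule.mem_bot R).1 hy], by simp⟩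

theorem range_baseChange_subtype_mono {N N' : Submodule R M} (h : N ≤ N') :
    LinearMap.range (N.subtype.baseChange S) ≤ LinearMap.range (N'.subtype.baseChange S) := by
  rw [← Submodule.subtype_comp_inclusion _ _ h, LinearMap.baseChange_comp]
  exact LinearMap.range_comp_le_range _ _

/-- This supplies upper bounds of chains for Zorn's lemma. -/
theorem IsAdapted.iSup {ι : Type*} [Nonempty ι] {N : ι → Submodule R M} {J : ι → Set I}
    (hdir : Directed (· ≤ ·) N) (h : ∀ i, IsAdapted s p (N i) (J i)) :
    IsAdapted s p (⨆ i, N i) (⋃ i, J i) := by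
  refine ⟨isPureInjection_subtype_iSup hdir fun i => (h i).pure, fun y hy i hi => ?_,
    fun i hi v => ?_⟩
  · obtain ⟨a, ha⟩ := (Submodule.mem_iSup_of_directed _ hdir).1 hy
    exact (h a).apply_eq_zero y ha i fun hia => hi (Set.mem_iUnion.2 ⟨a, hia⟩)
  · obtain ⟨a, ha⟩ := Set.mem_iUnion.1 hi
    exact range_baseChange_subtype_mono (le_iSup N a) ((h a).single_mem_range i ha v)

theorem IsAdapted.filter_mem_range {N : Submodule R M} {J : Set I} [DecidablePred (· ∈ J)]
    (h : IsAdapted s p N J) (x : Π₀ i, F i) :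
    p (x.filter (· ∈ J)) ∈ LinearMap.range (N.subtype.baseChange S) := by
  induction x using DFinsupp.induction with
  | h0 => simp
  | ha i v x _ _ hx =>
    rw [DFinsupp.filter_add, map_add]
    refine add_mem ?_ hx
    rw [DFinsupp.filter_single]
    split_ifs with hi
    · exact h.single_mem_range i hi v
    · simp

/-- An adapted submodule extends to an adapted submodule containing a given element, with
pure-projective quotient. -/
theorem IsAdapted.exists_extend [∀ i, Module.FinitePresentation S (F i)]
    (hS : IsPureExtension R S) (hps : p ∘ₗ s = LinearMap.id)
    {N : Submodule R M} {J : Set I} (h : IsAdapted s p N J) (x : M) :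
    ∃ (N' : Submodule R (M ⧸ N)) (J' : Set I), N.mkQ x ∈ N' ∧ IsPureProjective R N' ∧ J ⊆ J' ∧
      IsAdapted s p (N'.comap N.mkQ) J' := by
  classical
  let q : S ⊗[R] M →ₗ[S] S ⊗[R] (M ⧸ N) := N.mkQ.baseChange S
  have hq : Function.Surjective q := LinearMap.lTensor_surjective S N.mkQ_surjective
  have hqex : Function.Exact (N.subtype.baseChange S) q :=
    lTensor_exact S (LinearMap.exact_subtype_mkQ N) N.mkQ_surjective
  -- Deleting the summands in `J` makes `s` vanish on the image of `S ⊗ N`, so it descends to `S ⊗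
  -- (M ⧸ N)`.
  let fil : (Π₀ i, F i) →ₗ[S] Π₀ i, F i := DFinsupp.filterLinearMap S F (· ∉ J)
  have hfil (t : S ⊗[R] N) : fil (s (N.subtype.baseChange S t)) = 0 := by
    induction t with
    | zero => simp
    | add x y hx hy => rw [map_add, map_add, map_add, hx, hy, add_zero]
    | tmul a y =>
      have hy : fil (s (1 ⊗ₜ y.1)) = 0 := DFinsupp.ext fun i => by
        by_cases hi : i ∈ J
        · simp [fil, DFinsupp.filter_apply, hi]
        · simp [fil, DFinsupp.filter_apply, hi, h.apply_eq_zero y y.2 i hi]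
      rw [LinearMap.baseChange_tmul, Submodule.subtype_apply, ← mul_one a, ← smul_eq_mul,
        ← TensorProduct.smul_tmul', map_smul, map_smul, hy, smul_zero]
  obtain ⟨s', hs'⟩ := q.exists_comp_eq_of_ker_le hq (fil ∘ₗ s) (by
    rw [hqex.linearMap_ker_eq]
    rintro _ ⟨t, rfl⟩
    exact hfil t)
  -- The deleted part is harmless: `p` sends it into the image of `S ⊗ N`, which `q` kills.
  have hps' : (q ∘ₗ p) ∘ₗ s' = LinearMap.id := by
    rw [← LinearMap.cancel_right hq, LinearMap.comp_assoc, hs', LinearMap.id_comp]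
    refine LinearMap.ext fun z => ?_
    obtain ⟨t, ht⟩ := h.filter_mem_range (s z)
    have h1 : q (p ((s z).filter (· ∈ J))) = 0 := by rw [← ht, hqex.apply_apply_eq_zero]
    have h2 : p (s z) = z := LinearMap.congr_fun hps z
    calc q (p ((s z).filter (· ∉ J)))
        = q (p ((s z).filter (· ∈ J) + (s z).filter (· ∉ J))) := by
          rw [map_add, map_add, h1, zero_add]
      _ = q z := by rw [DFinsupp.filter_add_filter_not, h2]
  obtain ⟨N', J', hx, hpure, hpp, hz, hr⟩ := hS.exists_isPureProjective_submodule hps' (N.mkQ x)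
  refine ⟨N', J ∪ J', hx, hpp, Set.subset_union_left, h.pure.subtype_comap_mkQ hpure,
    fun y hy i hi => ?_, ?_⟩
  · have h1 := hz (N.mkQ y) hy i fun hi' => hi (Or.inr hi')
    have h2 : s' (1 ⊗ₜ N.mkQ y) = fil (s (1 ⊗ₜ y)) := LinearMap.congr_fun hs' (1 ⊗ₜ y)
    rw [h2] at h1
    simpa [fil, DFinsupp.filter_apply, show i ∉ J from fun hi' => hi (Or.inl hi')] using h1
  · rintro i (hi | hi) v
    · exact range_baseChange_subtype_mono (Submodule.le_comap_mkQ N N')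
        (h.single_mem_range i hi v)
    · obtain ⟨t, ht⟩ := hr i hi v
      obtain ⟨t, rfl⟩ := LinearMap.lTensor_surjective S (comapMkQ_surjective N') t
      have h1 : q ((N'.comap N.mkQ).subtype.baseChange S t) = q (p (DFinsupp.single i v)) := by
        refine Eq.trans ?_ ht
        rw [← LinearMap.comp_apply, ← LinearMap.baseChange_comp,
          ← subtype_comp_comapMkQ, LinearMap.baseChange_comp]
        rfl
      have h2 := (hqex (p (DFinsupp.single i v) - (N'.comap N.mkQ).subtype.baseChange S t)).1
        (by rw [map_sub, h1, sub_self])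
      have h3 := add_mem (range_baseChange_subtype_mono (Submodule.le_comap_mkQ N N') h2)
        (LinearMap.mem_range_self ((N'.comap N.mkQ).subtype.baseChange S) t)
      rwa [sub_add_cancel] at h3

/-- Pure-projectivity descends along pure extensions. -/
theorem IsPureProjective.of_baseChange {S : Type v} [CommRing S] [Algebra R S]
    (hS : IsPureExtension R S) (hM : IsPureProjective S (S ⊗[R] M)) : IsPureProjective R M := by
  classical
  obtain ⟨I, F, _, _, _, s, p, hps⟩ := hM.exists_retract
  intro A B C _ _ _ _ _ _ f g hfg h
  -- Recording `J` with each partial lift lets chains be bounded by the union of their index sets.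
  let lifts : Set ((M →ₗ.[R] B) × Set I) :=
    {x | IsAdapted s p x.1.domain x.2 ∧ g ∘ₗ x.1.toFun = h ∘ₗ x.1.domain.subtype}
  obtain ⟨⟨k, J⟩, -, hmax⟩ := zorn_le_nonempty₀ lifts (by
      intro c hc hchain y hy
      have : Nonempty c := ⟨⟨y, hy⟩⟩
      have hdir : DirectedOn (· ≤ ·) (Prod.fst '' c) :=
        (hchain.directedOn.mono_comp (g := Prod.fst) fun _ _ h => h.1)
      have hdom : (LinearPMap.sSup _ hdir).domain = ⨆ a : c, a.1.1.domain := by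
        rw [LinearPMap.domain_sSup, Set.image_image, sSup_image']
      have hdir' : Directed (· ≤ ·) fun a : c => a.1.1.domain :=
        fun a b => (hchain.directedOn.directed_val a b).imp fun _ h => ⟨h.1.1.1, h.2.1.1⟩
      refine ⟨(LinearPMap.sSup _ hdir, ⋃ a : c, a.1.2), ⟨?_, LinearMap.ext fun x => ?_⟩,
        fun a ha => ⟨LinearPMap.le_sSup hdir ⟨a, ha, rfl⟩,
          Set.subset_iUnion (fun a : c => a.1.2) ⟨a, ha⟩⟩⟩
      · dsimp only
        rw [hdom]
        exact IsAdapted.iSup hdir' fun a => (hc a.2).1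
      · obtain ⟨_, ⟨a, ha, rfl⟩, hx⟩ :=
          (LinearPMap.mem_domain_sSup_iff (Set.Nonempty.image _ ⟨y, hy⟩) hdir).1 x.2
        have h1 := LinearPMap.sSup_apply hdir ⟨a, ha, rfl⟩ ⟨x.1, hx⟩
        have h2 := LinearMap.congr_fun (hc ha).2 ⟨x.1, hx⟩
        exact (congr_arg g h1).trans h2)
    (⊥, ∅) ⟨isAdapted_bot, LinearMap.ext fun x => by
      rw [show x = 0 from Subtype.ext ((Submodule.mem_bot R).1 x.2), map_zero, map_zero]⟩
  have htop : k.domain = ⊤ := by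
    rw [eq_top_iff]
    rintro x -
    obtain ⟨N', J', hx, hpp, hJ, hN'⟩ := hmax.prop.1.exists_extend hS hps x
    obtain ⟨k', hk', hext⟩ := hmax.prop.1.pure.exists_extend_lift hpp hfg.pure hfg.exact
      hfg.surjective h k.toFun hmax.prop.2
    have hle : k ≤ ⟨N'.comap k.domain.mkQ, k'⟩ := by
      refine ⟨Submodule.le_comap_mkQ _ _, fun y z hyz => ?_⟩
      obtain rfl : z = Submodule.inclusion (Submodule.le_comap_mkQ k.domain N') y :=
        Subtype.ext hyz.symm
      exact (LinearMap.congr_fun hext y).symm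
    exact (hmax.le_of_ge (y := (⟨N'.comap k.domain.mkQ, k'⟩, J')) ⟨hN', hk'⟩ ⟨hle, hJ⟩).1.1 hx
  refine ⟨k.toFun ∘ₗ LinearMap.codRestrict k.domain LinearMap.id fun x => htop ▸ Submodule.mem_top,
    LinearMap.ext fun x => ?_⟩
  exact LinearMap.congr_fun hmax.prop.2 ⟨x, htop ▸ Submodule.mem_top⟩

end Descent

theorem mainTheorem3 :
    (∀ (R : Type u) (S : Type v) [CommRing R] [CommRing S] [Algebra R S],
      IsPureExtension R S →
      ∀ (M : Type w) [AddCommGroup M] [Module R M],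
        IsPureProjective R M ↔ IsPureProjective S (S ⊗[R] M)) ∧
    (∀ (R : Type u) [CommRing R] [IsLocalRing R] [IsNoetherianRing R]
      (P : Type w) [AddCommGroup P] [Module R P],
        IsPureProjective R P ↔
          IsPureProjective (AdicCompletion (IsLocalRing.maximalIdeal R) R)
            (AdicCompletion (IsLocalRing.maximalIdeal R) R ⊗[R] P)) :=
  ⟨fun _ S _ _ _ hS _ _ _ => ⟨fun h => h.baseChange S, .of_baseChange hS⟩,
    fun R _ _ _ _ _ _ => ⟨fun h => h.baseChange _,
      .of_baseChange (isPureExtension_adicCompletion R)⟩⟩
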